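/- Let $n\ge 0$ be an integer, let $U\subset\mathbb R^{2n}$ be an open disk of radius $1$ (Euclidean norm, any centre), with coordinates $x^1,\dots,x^{2n}$, and let $\omega=\sum_{i=1}^n dx^i\wedge dx^{i+n}$ be the canonical symplectic form. On smooth real differential forms on $U$ put $L\alpha=\omega\wedge\alpha$ and $\Lambda\alpha=\tfrac12(\omega^{-1})^{ij}\,\iota_{\partial_{x^i}}\iota_{\partial_{x^j}}\alpha=\sum_{i=1}^n\iota_{\partial_{x^{i+n}}}\iota_{\partial_{x^i}}\alpha$. A smooth $k$-form $B$ on $U$ is called primitive if $\Lambda B=0$; write $\mathcal P^k(U)$ for the space of primitive $k$-forms. For $B\in\mathcal P^{s}(U)$ with $1\le s\le n$ there are unique $B^0\in\mathcal P^{s+1}(U)$ and $B^1\in\mathcal P^{s-1}(U)$ with $dB=B^0+\omega\wedge B^1$, and one sets $\partial_-B=B^1$; on $\mathcal P^0(U)$ one sets $\partial_-=0$. For $0\le k<n$ let $$PH^k_{\partial_-}(U)=\frac{\ker(\partial_-)\cap\mathcal P^k(U)}{\operatorname{im}(\partial_-)\cap\mathcal P^k(U)},\qquad \operatorname{im}(\partial_-)\cap\mathcal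 P^k(U)=\partial_-\,\mathcal P^{k+1}(U).$$ **Proposition (primitive $\partial_-$-Poincaré lemma).** For every $0\le k<n$ one has $\dim PH^k_{\partial_-}(U)=0$. That is, for every $B\in\mathcal P^k(U)$ with $\partial_-B=0$ there is $A\in\mathcal P^{k+1}(U)$ with $\partial_-A=B$. -/

import Mathlib

open scoped ContDiff

namespace SymplecticDisk

/-- The space `ℝ²ⁿ`. The coordinate `xⁱ` is indexed by `Sum.inl i` and the coordinate
`xⁱ⁺ⁿ` by `Sum.inr i`, for `i : Fin n`. -/
abbrev Space (n : ℕ) : Type := EuclideanSpace ℝ (Fin n ⊕ Fin n)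

/-- Alternating real `k`-linear forms on `ℝ²ⁿ`: the values of differential `k`-forms. -/
abbrev Alt (n k : ℕ) : Type := Space n [⋀^Fin k]→L[ℝ] ℝ

/-- Differential `k`-forms on `ℝ²ⁿ`, without regularity. -/
abbrev Form (n k : ℕ) : Type := Space n → Alt n k

noncomputable instance instAddCommGroupForm (n k : ℕ) : AddCommGroup (Form n k) :=
  Pi.addCommGroup

/-- The coordinate covector `dxʲ`. -/
noncomputable def dx {n : ℕ} (j : Fin n ⊕ Fin n) : Space n →L[ℝ] ℝ :=
  EuclideanSpace.proj j

/-- The coordinate vector `∂/∂xʲ`. -/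
noncomputable def basisVec {n : ℕ} (j : Fin n ⊕ Fin n) : Space n :=
  EuclideanSpace.single j 1

/-- The wedge product `β ∧ α` of a covector `β` with a `k`-form `α`:
`(β ∧ α)(v₀, …, vₖ) = ∑ᵢ (-1)ⁱ β(vᵢ) α(v₀, …, v̂ᵢ, …, vₖ)`. -/
noncomputable def covectorWedge {n k : ℕ} (β : Space n →L[ℝ] ℝ) :
    Alt n k →ₗ[ℝ] Alt n (k + 1) where
  toFun α := ContinuousAlternatingMap.alternatizeUncurryFin (β.smulRight α)
  map_add' α α' := by
    rw [← ContinuousAlternatingMap.alternatizeUncurryFin_add]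
    congr 1
    ext v w
    simp
  map_smul' c α := by
    rw [RingHom.id_apply, ← ContinuousAlternatingMap.alternatizeUncurryFin_smul]
    congr 1
    ext v w
    simp [mul_left_comm]

/-- The interior product `ι_v α = α(v, ·, …, ·)`. -/
noncomputable def interior {n k : ℕ} (v : Space n) : Alt n (k + 1) →ₗ[ℝ] Alt n k where
  toFun α := α.curryLeft v
  map_add' _ _ := rfl
  map_smul' _ _ := rfl

/-- The Lefschetz operator `L α = ω ∧ α` of the canonical symplectic form
`ω = ∑ᵢ dxⁱ ∧ dxⁱ⁺ⁿ`. -/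
noncomputable def lefschetz (n k : ℕ) : Alt n k →ₗ[ℝ] Alt n (k + 2) :=
  ∑ i : Fin n, covectorWedge (dx (Sum.inl i)) ∘ₗ covectorWedge (dx (Sum.inr i))

/-- The dual Lefschetz operator `Λ α = ½ (ω⁻¹)ⁱʲ ι_{∂ᵢ} ι_{∂ⱼ} α`. For the canonical `ω` the
nonzero entries of the inverse matrix are `(ω⁻¹)^{i+n, i} = 1 = -(ω⁻¹)^{i, i+n}`, so
`Λ α = ∑ᵢ ι_{∂ᵢ₊ₙ} ι_{∂ᵢ} α`. It is zero on forms of degree `0` and `1`. -/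
noncomputable def dualLefschetz (n : ℕ) : (k : ℕ) → Alt n k →ₗ[ℝ] Alt n (k - 2)
  | 0 => 0
  | 1 => 0
  | _ + 2 => ∑ i : Fin n, interior (basisVec (Sum.inr i)) ∘ₗ interior (basisVec (Sum.inl i))

/-- Primitive `k`-forms on an open set `U`: smooth differential `k`-forms `B` on `U` with
`Λ B = 0`. A form on `U` is represented by a function on the whole space of which only the
values on `U` matter: every condition below is a condition on `U`. -/
noncomputable def primitiveForms {n : ℕ} (U : Set (Space n)) (k : ℕ) :
    Submodule ℝ (Form n k) where
  carrier := {B | ContDiffOn ℝ ∞ B U ∧ ∀ x ∈ U, dualLefschetz n k (B x) = 0}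
  zero_mem' := ⟨contDiffOn_const, fun _ _ => map_zero _⟩
  add_mem' {A B} hA hB := ⟨hA.1.add hB.1, fun x hx => by
    rw [Pi.add_apply, map_add, hA.2 x hx, hB.2 x hx, add_zero]⟩
  smul_mem' c A hA := ⟨hA.1.const_smul c, fun x hx => by
    rw [Pi.smul_apply, map_smul, hA.2 x hx, smul_zero]⟩

/-- The relation `∂₋ B = C` for a primitive `(s+1)`-form `B` and a primitive `s`-form `C` on `U`:
there is a primitive `(s+2)`-form `B⁰` with `dB = B⁰ + L C` on `U`. -/
def IsDelMinus {n : ℕ} (U : Set (Space n)) {s : ℕ}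
    (B : Form n (s + 1)) (C : Form n s) : Prop :=
  B ∈ primitiveForms U (s + 1) ∧ C ∈ primitiveForms U s ∧
    ∃ B₀ ∈ primitiveForms U (s + 2),
      ∀ x ∈ U, extDeriv B x = B₀ x + lefschetz n s (C x)

theorem IsDelMinus.zero {n : ℕ} (U : Set (Space n)) (s : ℕ) :
    IsDelMinus U (0 : Form n (s + 1)) 0 := by
  refine ⟨zero_mem _, zero_mem _, 0, zero_mem _, fun x _ => ?_⟩
  have h := extDeriv_smul (x := x) (0 : ℝ) (0 : Form n (s + 1))
  rw [zero_smul, zero_smul] at h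
  rw [h]
  simp

theorem IsDelMinus.add {n : ℕ} {U : Set (Space n)} (hU : IsOpen U) {s : ℕ}
    {B B' : Form n (s + 1)} {C C' : Form n s}
    (h : IsDelMinus U B C) (h' : IsDelMinus U B' C') : IsDelMinus U (B + B') (C + C') := by
  obtain ⟨hB, hC, B₀, hB₀, e⟩ := h
  obtain ⟨hB', hC', B₀', hB₀', e'⟩ := h'
  refine ⟨add_mem hB hB', add_mem hC hC', B₀ + B₀', add_mem hB₀ hB₀', fun x hx => ?_⟩
  rw [extDeriv_add ((hB.1.contDiffAt (hU.mem_nhds hx)).differentiableAt (by simp))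
    ((hB'.1.contDiffAt (hU.mem_nhds hx)).differentiableAt (by simp)), e x hx, e' x hx,
    Pi.add_apply, Pi.add_apply, map_add]
  abel

theorem IsDelMinus.smul {n : ℕ} {U : Set (Space n)} {s : ℕ}
    {B : Form n (s + 1)} {C : Form n s} (c : ℝ)
    (h : IsDelMinus U B C) : IsDelMinus U (c • B) (c • C) := by
  obtain ⟨hB, hC, B₀, hB₀, e⟩ := h
  refine ⟨Submodule.smul_mem _ c hB, Submodule.smul_mem _ c hC, c • B₀,
    Submodule.smul_mem _ c hB₀, fun x hx => ?_⟩
  rw [extDeriv_smul, e x hx, Pi.smul_apply, Pi.smul_apply, map_smul, smul_add]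

open TopologicalSpace in
/-- The `∂₋`-closed primitive `k`-forms on `U`, i.e. `ker ∂₋ ∩ 𝒫ᵏ(U)`. The operator `∂₋` lowers
the degree by one, so it is zero on `𝒫⁰(U)`. -/
noncomputable def delMinusClosed {n : ℕ} (U : Opens (Space n)) :
    (k : ℕ) → Submodule ℝ (Form n k)
  | 0 => primitiveForms U 0
  | _ + 1 =>
    { carrier := {B | IsDelMinus (U : Set (Space n)) B 0}
      zero_mem' := IsDelMinus.zero _ _
      add_mem' := fun hA hB => by simpa using IsDelMinus.add U.isOpen hA hB
      smul_mem' := fun c _ hA => by simpa using IsDelMinus.smul c hA }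

open TopologicalSpace in
/-- The `∂₋`-exact primitive `k`-forms on `U`, i.e. the image of `∂₋ : 𝒫ᵏ⁺¹(U) → 𝒫ᵏ(U)`. -/
noncomputable def delMinusExact {n : ℕ} (U : Opens (Space n)) (k : ℕ) :
    Submodule ℝ (Form n k) where
  carrier := {C | ∃ B, IsDelMinus (U : Set (Space n)) B C}
  zero_mem' := ⟨0, IsDelMinus.zero _ _⟩
  add_mem' := fun ⟨_, hA⟩ ⟨_, hB⟩ => ⟨_, IsDelMinus.add U.isOpen hA hB⟩
  smul_mem' := fun c _ ⟨_, hA⟩ => ⟨_, IsDelMinus.smul c hA⟩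

open TopologicalSpace in
/-- The primitive cohomology `PHᵏ_{∂₋}(U) = (ker ∂₋ ∩ 𝒫ᵏ(U)) / (im ∂₋ ∩ 𝒫ᵏ(U))`, for `k < n`.
Functions that vanish on `U` are exact, so the quotient does not see the values off `U`. -/
abbrev PrimitiveCohomology {n : ℕ} (U : Opens (Space n)) (k : ℕ) : Type :=
  delMinusClosed U k ⧸ (delMinusExact U k).submoduleOf (delMinusClosed U k)

/-- The open unit disk in `ℝ²ⁿ` with centre `c`. -/
def unitDisk {n : ℕ} (c : Space n) : TopologicalSpace.Opens (Space n) :=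
  ⟨Metric.ball c 1, Metric.isOpen_ball⟩

end SymplecticDisk

/-! Let `δ = ∑ⱼ ι_{eⱼ'} ∂ⱼ` be `codiff`, with `eⱼ'` the symplectic dual of `dxʲ`. For primitive `A`,
the commutator `[Λ, dxʲ ∧] = ι_{eⱼ'}` gives `Λ dA = δA`; for primitive `B` of degree `k`, `Λ L B =
(n - k) B`. Hence `∂₋A = B` amounts to `δA = (n - k) B`, and `∂₋`-closed means `δ`-closed. It
remains to solve `δA = F` with `A` primitive, for `F` primitive and coclosed.

Without primitivity this is a Poincaré lemma for `δ`: the homotopy wedges a radial average of `F`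
with `ι_{x - c} ω`, and Euler's identity does the rest (`exists_codiff_eq`). The solution is then
corrected. `Λ` commutes with `δ`, so `ΛA` is coclosed and `ΛA = δC`. Since `Λ` is onto in the
relevant degree (`surjective_contraction`), `C = ΛD`, and `A - δD` is primitive with the same
codifferential because `δ² = 0`. -/

open Set MeasureTheory intervalIntegral Topology

/-! ### Radial averages on a ball -/

section RadialAverage

variable {E F : Type} [NormedAddCommGroup E] [NormedSpace ℝ E]
  [NormedAddCommGroup F] [NormedSpace ℝ F]

/-- The weighted radial average `∫₀¹ tᵐ f(c + t (x - c)) dt`. -/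
noncomputable def radialAverage (c : E) (m : ℕ) (f : E → F) (x : E) : F :=
  ∫ t in (0 : ℝ)..1, t ^ m • f (c + t • (x - c))

theorem add_smul_sub_mem_ball {c x : E} {r t : ℝ} (hx : x ∈ Metric.ball c r)
    (ht : t ∈ Icc (0 : ℝ) 1) : c + t • (x - c) ∈ Metric.ball c r := by
  rw [mem_ball_iff_norm] at hx ⊢
  rw [add_sub_cancel_left, norm_smul, Real.norm_of_nonneg ht.1]
  exact (mul_le_of_le_one_left (norm_nonneg _) ht.2).trans_lt hx

theorem continuousOn_radial {c x : E} {r : ℝ} {f : E → F} (hf : ContinuousOn f (Metric.ball c r))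
    (hx : x ∈ Metric.ball c r) (m : ℕ) :
    ContinuousOn (fun t : ℝ => t ^ m • f (c + t • (x - c))) (uIcc 0 1) := by
  rw [uIcc_of_le zero_le_one]
  exact (by fun_prop : ContinuousOn (fun t : ℝ => t ^ m) (Icc 0 1)).smul
    (hf.comp (by fun_prop) fun t ht => add_smul_sub_mem_ball hx ht)

/-- Pointwise linear conditions thus survive averaging; coclosedness is one of them. -/
theorem radialAverage_clm_comp [CompleteSpace F] {G : Type} [NormedAddCommGroup G]
    [NormedSpace ℝ G] [CompleteSpace G] {c x : E} {r : ℝ} {f : E → F}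
    (hf : ContinuousOn f (Metric.ball c r)) (hx : x ∈ Metric.ball c r) (m : ℕ) (T : F →L[ℝ] G) :
    radialAverage c m (fun y => T (f y)) x = T (radialAverage c m f x) := by
  unfold radialAverage
  rw [← T.intervalIntegral_comp_comm (continuousOn_radial hf hx m).intervalIntegrable]
  simp

variable [FiniteDimensional ℝ E]

/-- Differentiation under the integral; the chain rule contributes a factor `t`, which raises the
weight by one. -/
theorem hasFDerivAt_radialAverage {c x : E} {r : ℝ} {f : E → F}
    (hf : ContDiffOn ℝ 1 f (Metric.ball c r)) (hx : x ∈ Metric.ball c r) (m : ℕ) :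
    HasFDerivAt (radialAverage c m f) (radialAverage c (m + 1) (fderiv ℝ f) x) x := by
  have hf' : ContinuousOn (fderiv ℝ f) (Metric.ball c r) :=
    hf.continuousOn_fderiv_of_isOpen Metric.isOpen_ball le_rfl
  -- The derivative may blow up at the boundary of the ball, so the dominating constant comes from a
  -- smaller closed ball, compact and star-shaped about `c`.
  obtain ⟨ρ, hxρ, hρ⟩ := exists_between (mem_ball_iff_norm.1 hx)
  have hsub : Metric.closedBall c ρ ⊆ Metric.ball c r := Metric.closedBall_subset_ball hρ
  obtain ⟨M, hM⟩ := (isCompact_closedBall c ρ).exists_bound_of_continuousOn (hf'.mono hsub)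
  have hmem : ∀ y ∈ Metric.ball c ρ, y ∈ Metric.ball c r := fun y hy =>
    hsub (Metric.ball_subset_closedBall hy)
  have hIoc : ∀ t ∈ uIoc (0 : ℝ) 1, t ∈ Icc (0 : ℝ) 1 := fun t ht => by
    rw [uIoc_of_le zero_le_one] at ht
    exact Ioc_subset_Icc_self ht
  have hxs : x ∈ Metric.ball c ρ := mem_ball_iff_norm.2 hxρ
  have hs : Metric.ball c ρ ∈ 𝓝 x := Metric.isOpen_ball.mem_nhds hxs
  refine hasFDerivAt_integral_of_dominated_of_fderiv_le
    (F' := fun y t => t ^ (m + 1) • fderiv ℝ f (c + t • (y - c)))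
    (bound := fun _ => M) hs ?_ ?_ ?_ ?_ ?_ ?_
  · filter_upwards [hs] with y hy
    exact ((continuousOn_radial hf.continuousOn (hmem y hy) m).mono
      uIoc_subset_uIcc).aestronglyMeasurable measurableSet_uIoc
  · exact (continuousOn_radial hf.continuousOn hx m).intervalIntegrable
  · exact ((continuousOn_radial hf' hx (m + 1)).mono
      uIoc_subset_uIcc).aestronglyMeasurable measurableSet_uIoc
  · refine Filter.Eventually.of_forall fun t ht y hy => ?_
    have h01 := hIoc t ht
    rw [norm_smul, norm_pow, Real.norm_of_nonneg h01.1]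
    exact (mul_le_of_le_one_left (norm_nonneg _) (pow_le_one₀ h01.1 h01.2)).trans
      (hM _ (Metric.ball_subset_closedBall (add_smul_sub_mem_ball hy h01)))
  · exact intervalIntegrable_const
  · refine Filter.Eventually.of_forall fun t ht y hy => ?_
    have hd : HasFDerivAt f (fderiv ℝ f (c + t • (y - c))) (c + t • (y - c)) :=
      ((hf.contDiffAt (Metric.isOpen_ball.mem_nhds
        (add_smul_sub_mem_ball (hmem y hy) (hIoc t ht)))).differentiableAt (by simp)).hasFDerivAt
    have hi : HasFDerivAt (fun y : E => c + t • (y - c)) (t • ContinuousLinearMap.id ℝ E) y :=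
      (((hasFDerivAt_id y).sub_const c).const_smul t).const_add c
    refine ((hd.comp y hi).const_smul (t ^ m)).congr_fderiv ?_
    ext v
    simp [pow_succ, mul_smul]

/-- `F` and `m` vary in the induction: each derivative is again a radial average, of `fderiv ℝ f`
with weight `m + 1`. -/
theorem contDiffOn_radialAverage {c : E} {r : ℝ} (k : ℕ) : ∀ {F : Type} [NormedAddCommGroup F]
    [NormedSpace ℝ F] {f : E → F} (_ : ContDiffOn ℝ ∞ f (Metric.ball c r)) (m : ℕ),
    ContDiffOn ℝ k (radialAverage c m f) (Metric.ball c r) := by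
  induction k with
  | zero =>
    intro F _ _ f hf m
    exact contDiffOn_zero.2 fun x hx => (hasFDerivAt_radialAverage
      (hf.of_le (by simp)) hx m).continuousAt.continuousWithinAt
  | succ k ih =>
    intro F _ _ f hf m
    have hd := fun x (hx : x ∈ Metric.ball c r) => hasFDerivAt_radialAverage
      (hf.of_le (by simp)) hx m
    rw [Nat.cast_succ, contDiffOn_succ_iff_fderiv_of_isOpen Metric.isOpen_ball]
    refine ⟨fun x hx => (hd x hx).differentiableAt.differentiableWithinAt, by simp, ?_⟩
    exact (ih (hf.fderiv_of_isOpen Metric.isOpen_ball (by simp)) (m + 1)).congr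
      fun x hx => (hd x hx).fderiv

theorem ContDiffOn.radialAverage {c : E} {r : ℝ} {f : E → F}
    (hf : ContDiffOn ℝ ∞ f (Metric.ball c r)) (m : ℕ) :
    ContDiffOn ℝ ∞ (radialAverage c m f) (Metric.ball c r) :=
  contDiffOn_infty.2 fun k => contDiffOn_radialAverage k hf m

/-- Euler's identity for radial averages. -/
theorem radialAverage_euler [CompleteSpace F] {c x : E} {r : ℝ} {f : E → F}
    (hf : ContDiffOn ℝ 1 f (Metric.ball c r)) (hx : x ∈ Metric.ball c r) (m : ℕ) :
    ((m : ℝ) + 1) • radialAverage c m f x + fderiv ℝ (radialAverage c m f) x (x - c) = f x := by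
  have hf' : ContinuousOn (fderiv ℝ f) (Metric.ball c r) :=
    hf.continuousOn_fderiv_of_isOpen Metric.isOpen_ball le_rfl
  have hv : ContinuousOn (fun y => fderiv ℝ f y (x - c)) (Metric.ball c r) :=
    hf'.clm_apply continuousOn_const
  have h1 : ContinuousOn (fun t : ℝ => ((m : ℝ) + 1) • t ^ m • f (c + t • (x - c))) (uIcc 0 1) :=
    (continuousOn_radial hf.continuousOn hx m).const_smul _
  have h2 := continuousOn_radial hv hx (m + 1)
  rw [(hasFDerivAt_radialAverage hf hx m).fderiv]
  have h3 := radialAverage_clm_comp hf' hx (m + 1) (ContinuousLinearMap.apply ℝ F (x - c))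
  simp only [ContinuousLinearMap.apply_apply] at h3
  rw [← h3]
  unfold _root_.radialAverage
  -- The integrand is the derivative of `t ^ (m + 1) • f (c + t • (x - c))`, which vanishes at `t =
  -- 0`.
  rw [← intervalIntegral.integral_smul, ← intervalIntegral.integral_add
    h1.intervalIntegrable h2.intervalIntegrable,
    integral_eq_sub_of_hasDerivAt
      (f' := fun t : ℝ => ((m : ℝ) + 1) • t ^ m • f (c + t • (x - c)) +
        t ^ (m + 1) • fderiv ℝ f (c + t • (x - c)) (x - c))
      (f := fun t : ℝ => t ^ (m + 1) • f (c + t • (x - c))) ?_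
      (h1.add h2).intervalIntegrable]
  · simp
  · intro t ht
    rw [uIcc_of_le zero_le_one] at ht
    have hd : HasFDerivAt f (fderiv ℝ f (c + t • (x - c))) (c + t • (x - c)) :=
      ((hf.contDiffAt (Metric.isOpen_ball.mem_nhds
        (add_smul_sub_mem_ball hx ht))).differentiableAt (by simp)).hasFDerivAt
    have hi : HasDerivAt (fun t : ℝ => c + t • (x - c)) (x - c) t := by
      simpa using ((hasDerivAt_id t).smul_const (x - c)).const_add c
    have := (hasDerivAt_pow (m + 1) t).smul (hd.comp_hasDerivAt t hi)
    refine this.congr_deriv ?_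
    simp only [Function.comp, Nat.cast_succ, Nat.add_sub_cancel, smul_smul]
    exact add_comm _ _

end RadialAverage

/-! ### Exterior algebra in coordinates -/

namespace SymplecticDisk

variable {n k : ℕ}

/-- Makes every linear operator on forms continuous, hence smooth. -/
instance finiteDimensional_alt (n k : ℕ) : FiniteDimensional ℝ (Alt n k) :=
  FiniteDimensional.of_injective
    ((AlternatingMap.toMultilinearMapLM (S := ℝ)).comp
      (ContinuousAlternatingMap.toAlternatingMapLinear (R := ℝ) :
        Alt n k →ₗ[ℝ] Space n [⋀^Fin k]→ₗ[ℝ] ℝ))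
    (AlternatingMap.coe_multilinearMap_injective.comp
      ContinuousAlternatingMap.toAlternatingMap_injective)

@[simp]
theorem interior_apply (v : Space n) (α : Alt n (k + 1)) (w : Fin k → Space n) :
    interior v α w = α (Fin.cons v w) := rfl

theorem covectorWedge_apply (β : Space n →L[ℝ] ℝ) (α : Alt n k) (v : Fin (k + 1) → Space n) :
    covectorWedge β α v = ∑ i : Fin (k + 1), (-1) ^ (i : ℕ) • (β (v i) * α (i.removeNth v)) := by
  refine (ContinuousAlternatingMap.alternatizeUncurryFin_apply _ v).trans ?_
  simp

theorem interior_neg (v : Space n) (α : Alt n (k + 1)) : interior (-v) α = -interior v α :=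
  map_neg α.curryLeft v

theorem interior_add (u v : Space n) (α : Alt n (k + 1)) :
    interior (u + v) α = interior u α + interior v α :=
  map_add α.curryLeft u v

theorem interior_self (v : Space n) (α : Alt n (k + 2)) : interior v (interior v α) = 0 :=
  ContinuousAlternatingMap.curryLeft_same α v

theorem interior_anticomm (u v : Space n) (α : Alt n (k + 2)) :
    interior u (interior v α) = -interior v (interior u α) := by
  have h := interior_self (u + v) α
  simp only [interior_add, map_add, interior_self, zero_add, add_zero] at h
  exact eq_neg_of_add_eq_zero_right h

theorem interior_covectorWedge_zero (v : Space n) (β : Space n →L[ℝ] ℝ) (α : Alt n 0) :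
    interior v (covectorWedge β α) = β v • α := by
  ext w
  simp [covectorWedge_apply, Subsingleton.elim _ w]

theorem interior_covectorWedge (v : Space n) (β : Space n →L[ℝ] ℝ) (α : Alt n (k + 1)) :
    interior v (covectorWedge β α) = β v • α - covectorWedge β (interior v α) := by
  ext w
  rw [interior_apply, covectorWedge_apply, Fin.sum_univ_succ, ContinuousAlternatingMap.sub_apply,
    covectorWedge_apply, sub_eq_add_neg, ← Finset.sum_neg_distrib]
  congr 1
  · simp
  · refine Finset.sum_congr rfl fun i _ => ?_
    rw [interior_apply]
    have : i.succ.removeNth (α := fun _ => Space n) (Fin.cons v w) =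
        Fin.cons v (i.removeNth w) := by
      ext1 j
      refine Fin.cases ?_ (fun j => ?_) j <;> simp [Fin.removeNth]
    rw [this]
    simp [pow_succ]

@[simp]
theorem dx_basisVec (i j : Fin n ⊕ Fin n) : dx i (basisVec j) = if i = j then 1 else 0 := by
  simp [dx, basisVec, PiLp.single_apply]

theorem sum_dx_smul_basisVec (v : Space n) : ∑ j, dx j v • basisVec j = v := by
  ext i
  cases i <;> simp [dx, basisVec, Pi.single_apply]

/-- For `T = fderiv ℝ F x` this is `d = ∑ⱼ dxʲ ∧ ∂ⱼ`. -/
theorem alternatizeUncurryFin_eq_sum (T : Space n →L[ℝ] Alt n k) :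
    ContinuousAlternatingMap.alternatizeUncurryFin T =
      ∑ j, covectorWedge (dx j) (T (basisVec j)) := by
  have hT : T = ∑ j, (dx j).smulRight (T (basisVec j)) := by
    ext1 v
    conv_lhs => rw [← sum_dx_smul_basisVec v, map_sum]
    simp
  conv_lhs => rw [hT]
  simp only [← ContinuousAlternatingMap.alternatizeUncurryFinCLM_apply, map_sum]
  rfl

theorem sum_covectorWedge_interior (α : Alt n (k + 1)) :
    ∑ j, covectorWedge (dx j) (interior (basisVec j) α) = ((k : ℝ) + 1) • α := by
  have h := ContinuousAlternatingMap.alternatizeUncurryFin_curryLeft α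
  rw [alternatizeUncurryFin_eq_sum] at h
  refine h.trans ?_
  rw [← Nat.cast_smul_eq_nsmul ℝ]
  push_cast
  rfl

/-! ### Lefschetz commutation relations -/

/-- The symplectic dual of the coordinate covector `dxʲ`. -/
noncomputable def dualVec : Fin n ⊕ Fin n → Space n
  | Sum.inl i => basisVec (Sum.inr i)
  | Sum.inr i => -basisVec (Sum.inl i)

/-- The dual Lefschetz operator in degrees at least two. -/
noncomputable def contraction (n k : ℕ) : Alt n (k + 2) →ₗ[ℝ] Alt n k :=
  dualLefschetz n (k + 2)

theorem contraction_apply (α : Alt n (k + 2)) : contraction n k α =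
    ∑ i : Fin n, interior (basisVec (Sum.inr i)) (interior (basisVec (Sum.inl i)) α) :=
  LinearMap.sum_apply _ _ _

theorem lefschetz_apply (α : Alt n k) : lefschetz n k α =
    ∑ i : Fin n, covectorWedge (dx (Sum.inl i)) (covectorWedge (dx (Sum.inr i)) α) :=
  LinearMap.sum_apply _ _ _

theorem contraction_covectorWedge_one (j : Fin n ⊕ Fin n) (α : Alt n (0 + 1)) :
    contraction n 0 (covectorWedge (dx j) α) = interior (dualVec j) α := by
  rw [contraction_apply]
  have h : ∀ i, interior (basisVec (Sum.inr i))
      (interior (basisVec (Sum.inl i)) (covectorWedge (dx j) α)) =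
      dx j (basisVec (Sum.inl i)) • interior (basisVec (Sum.inr i)) α -
      dx j (basisVec (Sum.inr i)) • interior (basisVec (Sum.inl i)) α := fun i => by
    rw [interior_covectorWedge, map_sub, map_smul, interior_covectorWedge_zero]
  rw [Finset.sum_congr rfl fun i _ => h i]
  cases j <;> simp [dualVec, interior_neg, ite_smul]

/-- Two uses of the antiderivation rule; only the index conjugate to `j` leaves an extra term. -/
theorem contraction_covectorWedge (j : Fin n ⊕ Fin n) (α : Alt n (k + 2)) :
    contraction n (k + 1) (covectorWedge (dx j) α) =
      covectorWedge (dx j) (contraction n k α) + interior (dualVec j) α := by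
  rw [contraction_apply, contraction_apply, map_sum]
  have h : ∀ i, interior (basisVec (Sum.inr i))
      (interior (basisVec (Sum.inl i)) (covectorWedge (dx j) α)) =
      covectorWedge (dx j) (interior (basisVec (Sum.inr i)) (interior (basisVec (Sum.inl i)) α)) +
      (dx j (basisVec (Sum.inl i)) • interior (basisVec (Sum.inr i)) α -
      dx j (basisVec (Sum.inr i)) • interior (basisVec (Sum.inl i)) α) := fun i => by
    rw [interior_covectorWedge, map_sub, map_smul, interior_covectorWedge]
    abel
  rw [Finset.sum_congr rfl fun i _ => h i, Finset.sum_add_distrib]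
  congr 1
  cases j <;> simp [dualVec, interior_neg, ite_smul]

theorem interior_contraction (v : Space n) (α : Alt n (k + 3)) :
    interior v (contraction n (k + 1) α) = contraction n k (interior v α) := by
  rw [contraction_apply, contraction_apply, map_sum]
  refine Finset.sum_congr rfl fun i _ => ?_
  rw [interior_anticomm v, interior_anticomm v, map_neg, neg_neg]

theorem sub_smul_alt (a b : ℝ) (α : Alt n k) : (a - b) • α = a • α - b • α := by
  ext v
  simp [sub_mul]

theorem contraction_lefschetz_zero (α : Alt n 0) :
    contraction n 0 (lefschetz n 0 α) = (n : ℝ) • α := by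
  rw [lefschetz_apply, map_sum]
  have h : ∀ i, contraction n 0
      (covectorWedge (dx (Sum.inl i)) (covectorWedge (dx (Sum.inr i)) α)) = α := fun i => by
    rw [contraction_covectorWedge_one, dualVec, interior_covectorWedge_zero, dx_basisVec,
      if_pos rfl, one_smul]
  rw [Finset.sum_congr rfl fun i _ => h i]
  simp [Nat.cast_smul_eq_nsmul]

theorem contraction_lefschetz_one (α : Alt n (0 + 1)) :
    contraction n (0 + 1) (lefschetz n (0 + 1) α) = ((n : ℝ) - 1) • α := by
  have e := sum_covectorWedge_interior α
  rw [Fintype.sum_sum_type, show ((0 : ℕ) : ℝ) + 1 = 1 by simp, one_smul] at e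
  rw [lefschetz_apply, map_sum]
  have h : ∀ i, contraction n (0 + 1)
      (covectorWedge (dx (Sum.inl i)) (covectorWedge (dx (Sum.inr i)) α)) =
      α - (covectorWedge (dx (Sum.inl i)) (interior (basisVec (Sum.inl i)) α) +
        covectorWedge (dx (Sum.inr i)) (interior (basisVec (Sum.inr i)) α)) := fun i => by
    rw [contraction_covectorWedge, contraction_covectorWedge_one, dualVec, dualVec,
      interior_covectorWedge, dx_basisVec, if_pos rfl, one_smul, interior_neg, map_neg]
    abel
  rw [Finset.sum_congr rfl fun i _ => h i, Finset.sum_sub_distrib, Finset.sum_add_distrib, e]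
  have h3 : ((n : ℝ) - 1) • α = (n : ℝ) • α - (1 : ℝ) • α := sub_smul_alt _ _ _
  rw [h3, Finset.sum_const, Finset.card_univ, Fintype.card_fin, ← Nat.cast_smul_eq_nsmul ℝ,
    one_smul]

/-- The relation `[Λ, L] = n - degree`: each conjugate pair contributes the identity minus its share
of the degree operator. -/
theorem contraction_lefschetz (α : Alt n (k + 2)) :
    contraction n (k + 2) (lefschetz n (k + 2) α) =
      lefschetz n k (contraction n k α) + ((n : ℝ) - (k + 2)) • α := by
  have e := sum_covectorWedge_interior α
  rw [Fintype.sum_sum_type] at e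
  rw [lefschetz_apply, lefschetz_apply, map_sum]
  have h : ∀ i, contraction n (k + 2)
      (covectorWedge (dx (Sum.inl i)) (covectorWedge (dx (Sum.inr i)) α)) =
      covectorWedge (dx (Sum.inl i)) (covectorWedge (dx (Sum.inr i)) (contraction n k α)) +
      (α - (covectorWedge (dx (Sum.inl i)) (interior (basisVec (Sum.inl i)) α) +
        covectorWedge (dx (Sum.inr i)) (interior (basisVec (Sum.inr i)) α))) := fun i => by
    rw [contraction_covectorWedge, contraction_covectorWedge, dualVec, dualVec,
      interior_covectorWedge, dx_basisVec, if_pos rfl, one_smul, interior_neg, map_add, map_neg]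
    abel
  rw [Finset.sum_congr rfl fun i _ => h i, Finset.sum_add_distrib, Finset.sum_sub_distrib,
    Finset.sum_add_distrib, e]
  have h2 : ((k + 1 : ℕ) : ℝ) + 1 = k + 2 := by push_cast; ring
  have h3 : ((n : ℝ) - (k + 2)) • α = (n : ℝ) • α - ((k : ℝ) + 2) • α := sub_smul_alt _ _ _
  rw [h2, h3, Finset.sum_const, Finset.card_univ, Fintype.card_fin, ← Nat.cast_smul_eq_nsmul ℝ]

theorem contraction_lefschetz_of_primitive : ∀ {k : ℕ} {α : Alt n k},
    dualLefschetz n k α = 0 → contraction n k (lefschetz n k α) = ((n : ℝ) - k) • α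
  | 0, α, _ => by simpa using contraction_lefschetz_zero α
  | 1, α, _ => by simpa using contraction_lefschetz_one α
  | k + 2, α, h => by
    rw [contraction_lefschetz, show contraction n k α = 0 from h]
    simp

/-- The shift `t` makes the induction close: in degree `k + 2`, `ΛL + t = LΛ + s` with `s > 0`, and
solving `LΛ + s` reduces to solving `ΛL + s` in degree `k`. -/
theorem surjective_contraction_lefschetz_add : ∀ {k : ℕ}, k < n → ∀ {t : ℝ}, 0 ≤ t →
    ∀ α : Alt n k, ∃ β, contraction n k (lefschetz n k β) + t • β = α
  | 0, hk, t, ht, α => by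
    have hn : (0 : ℝ) < n + t := add_pos_of_pos_of_nonneg (by exact_mod_cast hk) ht
    refine ⟨((n : ℝ) + t)⁻¹ • α, ?_⟩
    rw [contraction_lefschetz_zero, ← add_smul, smul_inv_smul₀ hn.ne']
  | 1, hk, t, ht, α => by
    have h1 : (1 : ℝ) < n := by exact_mod_cast hk
    have hn : 0 < (n : ℝ) - 1 + t := by linarith
    refine ⟨((n : ℝ) - 1 + t)⁻¹ • α, ?_⟩
    rw [contraction_lefschetz_one, ← add_smul, smul_inv_smul₀ hn.ne']
  | k + 2, hk, t, ht, α => by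
    have h1 : (k : ℝ) + 2 < n := by exact_mod_cast hk
    have hs : 0 < (n : ℝ) - (k + 2) + t := by linarith
    obtain ⟨γ, hγ⟩ := surjective_contraction_lefschetz_add (by omega : k < n) hs.le
      (contraction n k α)
    refine ⟨((n : ℝ) - (k + 2) + t)⁻¹ • (α - lefschetz n k γ), ?_⟩
    rw [contraction_lefschetz, add_assoc, ← add_smul, smul_inv_smul₀ hs.ne']
    simp only [map_smul, map_sub]
    rw [← map_sub, ← hγ, add_sub_cancel_left, map_smul, inv_smul_smul₀ hs.ne']
    abel

theorem surjective_contraction (hk : k < n) :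
    Function.Surjective (contraction n k) := fun α => by
  obtain ⟨β, hβ⟩ := surjective_contraction_lefschetz_add hk le_rfl α
  exact ⟨lefschetz n k β, by simpa using hβ⟩

/-! ### The symplectic codifferential -/

variable {U : Set (Space n)}

/-- The symplectic codifferential `∑ⱼ ι_{eⱼ'} ∂ⱼ F` (up to sign). -/
noncomputable def codiff (F : Form n (k + 1)) : Form n k := fun x =>
  ∑ j, interior (dualVec j) (fderiv ℝ F x (basisVec j))

/-- A linear map of alternating forms commutes with the partial derivatives. -/
theorem fderiv_linearMap_comp {l m : ℕ} (T : Alt n l →ₗ[ℝ] Alt n m) {F : Form n l} {x : Space n}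
    (hF : DifferentiableAt ℝ F x) (v : Space n) :
    fderiv ℝ (fun y => T (F y)) x v = T (fderiv ℝ F x v) := by
  have := (T.toContinuousLinearMap.hasFDerivAt.comp x hF.hasFDerivAt).fderiv
  exact congrArg (· v) this

theorem contDiffOn_linearMap_comp {l m : ℕ} {N : WithTop ℕ∞} (T : Alt n l →ₗ[ℝ] Alt n m)
    {F : Form n l} (hF : ContDiffOn ℝ N F U) : ContDiffOn ℝ N (fun y => T (F y)) U :=
  T.toContinuousLinearMap.contDiff.comp_contDiffOn hF

theorem contDiffOn_fderiv_apply (hU : IsOpen U) {F : Form n k} (hF : ContDiffOn ℝ ∞ F U)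
    (v : Space n) : ContDiffOn ℝ ∞ (fun x => fderiv ℝ F x v) U :=
  (hF.fderiv_of_isOpen hU (by simp)).clm_apply contDiffOn_const

theorem contDiffOn_codiff (hU : IsOpen U) {F : Form n (k + 1)} (hF : ContDiffOn ℝ ∞ F U) :
    ContDiffOn ℝ ∞ (codiff F) U :=
  ContDiffOn.sum fun _ _ => contDiffOn_linearMap_comp _ (contDiffOn_fderiv_apply hU hF _)

theorem ContDiffOn.differentiableAt_of_isOpen (hU : IsOpen U) {F : Form n k}
    (hF : ContDiffOn ℝ ∞ F U) {x : Space n} (hx : x ∈ U) : DifferentiableAt ℝ F x :=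
  (hF.contDiffAt (hU.mem_nhds hx)).differentiableAt (by simp)

theorem codiff_sub {F G : Form n (k + 1)} {x : Space n} (hF : DifferentiableAt ℝ F x)
    (hG : DifferentiableAt ℝ G x) : codiff (F - G) x = codiff F x - codiff G x := by
  simp only [codiff, fderiv_sub hF hG, sub_apply, map_sub,
    Finset.sum_sub_distrib]

theorem contraction_codiff {F : Form n (k + 3)} {x : Space n} (hF : DifferentiableAt ℝ F x) :
    contraction n k (codiff F x) = codiff (fun y => contraction n (k + 1) (F y)) x := by
  simp only [codiff, map_sum]
  refine Finset.sum_congr rfl fun j _ => ?_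
  rw [fderiv_linearMap_comp _ hF, interior_contraction]

/-- Second derivatives commute while contractions anticommute. -/
theorem codiff_codiff (hU : IsOpen U) {F : Form n (k + 2)} (hF : ContDiffOn ℝ ∞ F U) {x : Space n}
    (hx : x ∈ U) : codiff (codiff F) x = 0 := by
  have hd : ∀ v, DifferentiableAt ℝ (fun y => fderiv ℝ F y v) x := fun v =>
    ContDiffOn.differentiableAt_of_isOpen hU (contDiffOn_fderiv_apply hU hF v) hx
  have hd' : DifferentiableAt ℝ (fderiv ℝ F) x :=
    ((hF.fderiv_of_isOpen hU (m := ∞) (by simp)).contDiffAt (hU.mem_nhds hx)).differentiableAt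
      (by simp)
  have hsymm : ∀ v w, fderiv ℝ (fderiv ℝ F) x v w = fderiv ℝ (fderiv ℝ F) x w v :=
    (hF.contDiffAt (hU.mem_nhds hx)).isSymmSndFDerivAt (by
      rw [minSmoothness_of_isRCLikeNormedField]; exact WithTop.coe_le_coe.2 le_top)
  have e : codiff (codiff F) x = ∑ j, ∑ l, interior (dualVec j) (interior (dualVec l)
      (fderiv ℝ (fderiv ℝ F) x (basisVec j) (basisVec l))) := by
    refine Finset.sum_congr rfl fun j _ => ?_
    have h1 : fderiv ℝ (codiff F) x (basisVec j) = ∑ l, interior (dualVec l)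
        (fderiv ℝ (fderiv ℝ F) x (basisVec j) (basisVec l)) := by
      unfold codiff
      rw [fderiv_fun_sum fun l _ => ?_, sum_apply]
      · refine Finset.sum_congr rfl fun l _ => ?_
        rw [fderiv_linearMap_comp _ (hd _), fderiv_clm_apply hd' (differentiableAt_const _)]
        simp
      · exact (interior (k := k + 1) (dualVec l)).toContinuousLinearMap.differentiableAt.comp x
          (hd _)
    rw [h1, map_sum]
  suffices hs : codiff (codiff F) x = -codiff (codiff F) x by
    ext v
    have := congrArg (fun α : Alt n k => α v) hs
    simp only [ContinuousAlternatingMap.neg_apply] at this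
    exact self_eq_neg.1 this
  rw [e]
  conv_lhs => rw [Finset.sum_comm]
  rw [← Finset.sum_neg_distrib]
  refine Finset.sum_congr rfl fun j _ => ?_
  rw [← Finset.sum_neg_distrib]
  refine Finset.sum_congr rfl fun l _ => ?_
  rw [hsymm, interior_anticomm]

/-- The partial derivatives of a primitive form are primitive, so in `Λ(dxʲ ∧ ∂ⱼF)` only the
commutator term survives. -/
theorem contraction_extDeriv (hU : IsOpen U) {F : Form n (k + 1)} (hF : F ∈ primitiveForms U (k + 1))
    {x : Space n} (hx : x ∈ U) : contraction n k (extDeriv F x) = codiff F x := by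
  rw [extDeriv, alternatizeUncurryFin_eq_sum, map_sum]
  refine Finset.sum_congr rfl fun j _ => ?_
  cases k with
  | zero => exact contraction_covectorWedge_one j _
  | succ k =>
    have hd := ContDiffOn.differentiableAt_of_isOpen hU hF.1 hx
    have h0 : contraction n k (fderiv ℝ F x (basisVec j)) = 0 := by
      rw [← fderiv_linearMap_comp _ hd]
      have : (fun y => contraction n k (F y)) =ᶠ[𝓝 x] fun _ => 0 :=
        Filter.eventuallyEq_of_mem (hU.mem_nhds hx) hF.2
      rw [this.fderiv_eq]
      simp
    rw [contraction_covectorWedge, h0, map_zero, zero_add]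

/-! ### Poincaré lemma for the codifferential -/

/-- The covector with value `1` on `dualVec j` and `0` on the other vectors `dualVec l`. -/
noncomputable def dualCovec : Fin n ⊕ Fin n → Space n →L[ℝ] ℝ
  | Sum.inl i => dx (Sum.inr i)
  | Sum.inr i => -dx (Sum.inl i)

theorem dualCovec_dualVec (i j : Fin n ⊕ Fin n) :
    dualCovec i (dualVec j) = if i = j then 1 else 0 := by
  cases i <;> cases j <;> simp [dualCovec, dualVec]

/-- The symbol `∑ⱼ ι_{eⱼ'} (ξ ∧ Tⱼ)`. -/
noncomputable def wedgeTrace (ξ : Space n →L[ℝ] ℝ) :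
    (Space n →L[ℝ] Alt n k) →ₗ[ℝ] Alt n k where
  toFun T := ∑ j, (interior (dualVec j) (covectorWedge ξ (T (basisVec j))) -
    ξ (dualVec j) • T (basisVec j))
  map_add' S T := by
    rw [← Finset.sum_add_distrib]
    refine Finset.sum_congr rfl fun j _ => ?_
    simp only [add_apply, map_add, smul_add]
    abel
  map_smul' c T := by
    rw [RingHom.id_apply, Finset.smul_sum]
    refine Finset.sum_congr rfl fun j _ => ?_
    simp only [smul_apply, map_smul, smul_sub, smul_comm c]

theorem wedgeTrace_apply (ξ : Space n →L[ℝ] ℝ) (T : Space n →L[ℝ] Alt n k) :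
    wedgeTrace ξ T = ∑ j, (interior (dualVec j) (covectorWedge ξ (T (basisVec j))) -
      ξ (dualVec j) • T (basisVec j)) := rfl

theorem wedgeTrace_zero (ξ : Space n →L[ℝ] ℝ) (T : Space n →L[ℝ] Alt n 0) :
    wedgeTrace ξ T = 0 := by
  rw [wedgeTrace_apply]
  exact Finset.sum_eq_zero fun j _ => by rw [interior_covectorWedge_zero, sub_self]

/-- Shows that coclosed forms have zero trace; the trace also makes sense in degree zero, where
`codiff` has no target. -/
theorem wedgeTrace_succ (ξ : Space n →L[ℝ] ℝ) (F : Form n (k + 1)) (x : Space n) :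
    wedgeTrace ξ (fderiv ℝ F x) = -covectorWedge ξ (codiff F x) := by
  rw [wedgeTrace_apply, codiff, map_sum, ← Finset.sum_neg_distrib]
  exact Finset.sum_congr rfl fun j _ => by rw [interior_covectorWedge]; abel

theorem covectorWedge_neg (β : Space n →L[ℝ] ℝ) (α : Alt n k) :
    covectorWedge (-β) α = -covectorWedge β α := by
  ext v
  simp [covectorWedge_apply, ← Finset.sum_neg_distrib]

/-- Counts dimension minus degree, since `dualVec` and `dualCovec` are dual bases. -/
theorem sum_interior_covectorWedge (α : Alt n k) :
    ∑ j, interior (dualVec j) (covectorWedge (dualCovec j) α) = (2 * (n : ℝ) - k) • α := by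
  have e : ∑ j, interior (dualVec j) (covectorWedge (dualCovec j) α) =
      ∑ j, interior (basisVec j) (covectorWedge (dx j) α) := by
    rw [Fintype.sum_sum_type, Fintype.sum_sum_type, add_comm]
    simp [dualVec, dualCovec, interior_neg, covectorWedge_neg]
  have hc : ∑ _j : Fin n ⊕ Fin n, α = (2 * (n : ℝ)) • α := by
    rw [Finset.sum_const, Finset.card_univ, Fintype.card_sum, Fintype.card_fin,
      ← Nat.cast_smul_eq_nsmul ℝ, two_mul, Nat.cast_add]
  rw [e]
  cases k with
  | zero =>
    simp only [interior_covectorWedge_zero, dx_basisVec, if_true, one_smul, hc]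
    simp
  | succ k =>
    have h3 : (2 * (n : ℝ) - (k + 1 : ℕ)) • α = (2 * (n : ℝ)) • α - ((k + 1 : ℕ) : ℝ) • α :=
      sub_smul_alt _ _ _
    simp only [interior_covectorWedge, dx_basisVec, if_true, one_smul, Finset.sum_sub_distrib]
    rw [hc, sum_covectorWedge_interior, h3, Nat.cast_succ]

/-- The Poincaré lemma for the symplectic codifferential: a coclosed form of degree `k < 2n` on a
ball is coexact. The hypothesis says that `F` is coclosed, and it is vacuous in degree zero. -/
theorem exists_codiff_eq {c : Space n} {r : ℝ} (hk : k < 2 * n) {F : Form n k}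
    (hF : ContDiffOn ℝ ∞ F (Metric.ball c r))
    (h : ∀ x ∈ Metric.ball c r, ∀ ξ, wedgeTrace ξ (fderiv ℝ F x) = 0) :
    ∃ A : Form n (k + 1), ContDiffOn ℝ ∞ A (Metric.ball c r) ∧
      ∀ x ∈ Metric.ball c r, codiff A x = F x := by
  -- Chosen so that Euler's coefficient `m + 1` equals `2n - k`.
  obtain ⟨m, hm⟩ : ∃ m, 2 * n = k + m + 1 := ⟨2 * n - k - 1, by omega⟩
  set G := radialAverage c m F with hG
  have hGs : ContDiffOn ℝ ∞ G (Metric.ball c r) := ContDiffOn.radialAverage hF m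
  have hA : ∀ j, ContDiffOn ℝ ∞ (fun x => dx j (x - c) • covectorWedge (dualCovec j) (G x))
      (Metric.ball c r) := fun j =>
    ((dx j).contDiff.comp (contDiff_id.sub contDiff_const)).contDiffOn.smul
      (contDiffOn_linearMap_comp _ hGs)
  -- The witness is `(ι_{x - c} ω) ∧ G`.
  refine ⟨fun x => ∑ j, dx j (x - c) • covectorWedge (dualCovec j) (G x),
    ContDiffOn.sum fun j _ => hA j, fun x hx => ?_⟩
  have hGd := ContDiffOn.differentiableAt_of_isOpen Metric.isOpen_ball hGs hx
  have hcl : ∀ ξ, wedgeTrace ξ (fderiv ℝ G x) = 0 := fun ξ => by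
    have hc : ContinuousOn (fderiv ℝ F) (Metric.ball c r) :=
      hF.continuousOn_fderiv_of_isOpen Metric.isOpen_ball (by simp)
    rw [hG, (hasFDerivAt_radialAverage (hF.of_le (by simp)) hx m).fderiv]
    have := radialAverage_clm_comp (F := Space n →L[ℝ] Alt n k) (G := Alt n k) hc hx (m + 1)
      (LinearMap.toContinuousLinearMap (E := Space n →L[ℝ] Alt n k) (F' := Alt n k)
        (wedgeTrace ξ))
    simp only [LinearMap.coe_toContinuousLinearMap'] at this
    rw [← this]
    refine intervalIntegral.integral_zero_ae (Filter.Eventually.of_forall fun t ht => ?_)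
    rw [uIoc_of_le zero_le_one] at ht
    exact smul_eq_zero_of_right _ (h _ (add_smul_sub_mem_ball hx (Ioc_subset_Icc_self ht)) ξ)
  have hd : ∀ l, fderiv ℝ (fun x => ∑ j, dx j (x - c) • covectorWedge (dualCovec j) (G x)) x
      (basisVec l) = covectorWedge (dualCovec l) (G x) +
        ∑ j, dx j (x - c) • covectorWedge (dualCovec j) (fderiv ℝ G x (basisVec l)) := fun l => by
    rw [fderiv_fun_sum fun j _ =>
      ContDiffOn.differentiableAt_of_isOpen Metric.isOpen_ball (hA j) hx,
      sum_apply]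
    have hj : ∀ j, fderiv ℝ (fun x => dx j (x - c) • covectorWedge (dualCovec j) (G x)) x
        (basisVec l) = (if j = l then 1 else 0 : ℝ) • covectorWedge (dualCovec j) (G x) +
          dx j (x - c) • covectorWedge (dualCovec j) (fderiv ℝ G x (basisVec l)) := fun j => by
      have h1 : HasFDerivAt (fun x => dx j (x - c)) (dx j) x :=
        (dx j).hasFDerivAt.comp x ((hasFDerivAt_id x).sub_const c)
      have h2 : DifferentiableAt ℝ (fun x => covectorWedge (dualCovec j) (G x)) x :=
        ContDiffOn.differentiableAt_of_isOpen Metric.isOpen_ball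
          (contDiffOn_linearMap_comp _ hGs) hx
      rw [(h1.fun_smul h2.hasFDerivAt).fderiv, add_apply,
        smul_apply, fderiv_linearMap_comp _ hGd,
        ContinuousLinearMap.smulRight_apply, dx_basisVec]
      exact add_comm _ _
    rw [Finset.sum_congr rfl fun j _ => hj j, Finset.sum_add_distrib]
    simp [ite_smul]
  -- Coclosedness enters here, with `ξ = dualCovec j`.
  have hw : ∀ j, ∑ l, interior (dualVec l)
      (covectorWedge (dualCovec j) (fderiv ℝ G x (basisVec l))) = fderiv ℝ G x (basisVec j) :=
      fun j => by
    have := hcl (dualCovec j)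
    simp only [wedgeTrace_apply, Finset.sum_sub_distrib,
      dualCovec_dualVec, ite_smul, one_smul, zero_smul, Finset.sum_ite_eq, Finset.mem_univ,
      if_true] at this
    exact sub_eq_zero.1 this
  have hv : fderiv ℝ G x (x - c) = ∑ j, dx j (x - c) • fderiv ℝ G x (basisVec j) := by
    conv_lhs => rw [← sum_dx_smul_basisVec (x - c), map_sum]
    simp only [map_smul]
  have hcoef : 2 * (n : ℝ) - k = m + 1 := by
    have : (2 * n : ℝ) = k + m + 1 := by exact_mod_cast hm
    linarith
  have euler := radialAverage_euler (hF.of_le (by simp)) hx m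
  rw [← hG, hv, ← hcoef, ← sum_interior_covectorWedge] at euler
  rw [← euler]
  simp only [codiff, hd, map_add, Finset.sum_add_distrib, map_sum, map_smul]
  congr 1
  rw [Finset.sum_comm]
  simp only [← Finset.smul_sum, hw]

/-! ### Primitive solutions and the conclusion -/

/-- Primitive coclosed forms of degree `k < n` on a ball are the codifferentials of primitive
forms. -/
theorem exists_primitive_codiff_eq {c : Space n} {r : ℝ} (hk : k < n) {F : Form n k}
    (hF : F ∈ primitiveForms (Metric.ball c r) k)
    (h : ∀ x ∈ Metric.ball c r, ∀ ξ, wedgeTrace ξ (fderiv ℝ F x) = 0) :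
    ∃ A ∈ primitiveForms (Metric.ball c r) (k + 1),
      ∀ x ∈ Metric.ball c r, codiff A x = F x := by
  obtain ⟨A, hA, hAF⟩ := exists_codiff_eq (by omega) hF.1 h
  cases k with
  | zero => exact ⟨A, ⟨hA, fun _ _ => rfl⟩, hAF⟩
  | succ k =>
    have hU : IsOpen (Metric.ball c r) := Metric.isOpen_ball
    have hΛA : ∀ x ∈ Metric.ball c r, ∀ ξ,
        wedgeTrace ξ (fderiv ℝ (fun y => contraction n k (A y)) x) = 0 := by
      intro x hx ξ
      cases k with
      | zero => exact wedgeTrace_zero _ _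
      | succ k =>
        rw [wedgeTrace_succ, ← contraction_codiff
          (ContDiffOn.differentiableAt_of_isOpen hU hA hx), hAF x hx,
          show contraction n k (F x) = 0 from hF.2 x hx, map_zero, neg_zero]
    obtain ⟨C, hC, hCA⟩ := exists_codiff_eq (by omega) (contDiffOn_linearMap_comp _ hA) hΛA
    obtain ⟨R, hR⟩ := (contraction n (k + 1)).exists_rightInverse_of_surjective
      (LinearMap.range_eq_top.2 (surjective_contraction hk))
    have hR' : ∀ y, contraction n (k + 1) (R y) = y := fun y => LinearMap.congr_fun hR y
    have hD : ContDiffOn ℝ ∞ (fun y => R (C y)) (Metric.ball c r) :=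
      contDiffOn_linearMap_comp R hC
    have hδD := contDiffOn_codiff hU hD
    -- With `D = R ∘ C`: `Λ δD = δ ΛD = δC = ΛA`, and `δδD = 0`.
    refine ⟨A - codiff fun y => R (C y), ⟨hA.sub hδD, fun x hx => ?_⟩, fun x hx => ?_⟩
    · change contraction n k (A x - codiff (fun y => R (C y)) x) = 0
      rw [map_sub, contraction_codiff (ContDiffOn.differentiableAt_of_isOpen hU hD hx)]
      simp only [hR']
      rw [hCA x hx, sub_self]
    · rw [codiff_sub (ContDiffOn.differentiableAt_of_isOpen hU hA hx)
        (ContDiffOn.differentiableAt_of_isOpen hU hδD hx), codiff_codiff hU hD hx, sub_zero,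
        hAF x hx]

theorem contDiffOn_extDeriv (hU : IsOpen U) {F : Form n k} (hF : ContDiffOn ℝ ∞ F U) :
    ContDiffOn ℝ ∞ (extDeriv F) U :=
  (ContinuousAlternatingMap.alternatizeUncurryFinCLM ℝ (Space n) ℝ).contDiff.comp_contDiffOn
    (hF.fderiv_of_isOpen hU (by simp))

theorem exists_isDelMinus (hk : k < n) (c : Space n) {B : Form n k}
    (hB : B ∈ delMinusClosed (unitDisk c) k) :
    ∃ A, IsDelMinus (unitDisk c : Set (Space n)) A B := by
  have hU : IsOpen (Metric.ball c 1) := Metric.isOpen_ball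
  have hprim : B ∈ primitiveForms (Metric.ball c 1) k := by
    cases k with
    | zero => exact hB
    | succ k => exact hB.1
  -- The factor `n - k` is the eigenvalue of `ΛL` on primitive `k`-forms.
  have hcl : ∀ x ∈ Metric.ball c 1, ∀ ξ,
      wedgeTrace ξ (fderiv ℝ (((n : ℝ) - k) • B) x) = 0 := by
    intro x hx ξ
    rw [fderiv_const_smul (ContDiffOn.differentiableAt_of_isOpen hU hprim.1 hx), map_smul]
    cases k with
    | zero => rw [wedgeTrace_zero, smul_zero]
    | succ k =>
      obtain ⟨-, -, B₀, hB₀, e⟩ := hB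
      rw [wedgeTrace_succ, ← contraction_extDeriv hU hprim hx, e x hx]
      rw [Pi.zero_apply, map_zero, add_zero, show contraction n k (B₀ x) = 0 from hB₀.2 x hx,
        map_zero, neg_zero, smul_zero]
  obtain ⟨A, hA, hAB⟩ := exists_primitive_codiff_eq hk (Submodule.smul_mem _ _ hprim) hcl
  -- `B⁰ = dA - LB` is primitive, as `Λ dA = δA = (n - k) B = Λ L B`.
  refine ⟨A, hA, hprim, fun x => extDeriv A x - lefschetz n k (B x), ⟨?_, fun x hx => ?_⟩,
    fun x _ => (sub_add_cancel _ _).symm⟩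
  · exact (contDiffOn_extDeriv hU hA.1).sub (contDiffOn_linearMap_comp _ hprim.1)
  · change contraction n k (extDeriv A x - lefschetz n k (B x)) = 0
    rw [map_sub, contraction_extDeriv hU hA hx, hAB x hx,
      contraction_lefschetz_of_primitive (hprim.2 x hx)]
    exact sub_self _

end SymplecticDisk

theorem proposition3p12 (n k : ℕ) (hk : k < n) (c : SymplecticDisk.Space n) :
    Module.rank ℝ (SymplecticDisk.PrimitiveCohomology (SymplecticDisk.unitDisk c) k) = 0 ∧
    ∀ B ∈ SymplecticDisk.delMinusClosed (SymplecticDisk.unitDisk c) k,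
      ∃ A, SymplecticDisk.IsDelMinus (SymplecticDisk.unitDisk c : Set (SymplecticDisk.Space n))
        A B := by
  have h := fun B hB => SymplecticDisk.exists_isDelMinus hk c (B := B) hB
  refine ⟨?_, h⟩
  have : Subsingleton (SymplecticDisk.PrimitiveCohomology (SymplecticDisk.unitDisk c) k) :=
    Submodule.Quotient.subsingleton_iff.2 (eq_top_iff.2 fun B _ => h B.1 B.2)
  exact rank_subsingleton' ℝ _
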